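/- Let $A$ be a quasi-Frobenius ring (left and right Noetherian, left and right self-injective), let $(\mathcal{C},\Delta,\varepsilon)$ be an $A$-coring, and let $K,L\subseteq\mathcal{C}$ be $(A,A)$-subbimodules. A right (left) $\mathcal{C}$-coideal is a right (left) $A$-submodule of $\mathcal{C}$ which is a right (left) $\mathcal{C}$-comodule with coaction the restriction of $\Delta$; a $\mathcal{C}$-bicoideal is a subbimodule which is a $(\mathcal{C},\mathcal{C})$-bicomodule with coactions the restrictions of $\Delta$. Let $\mathrm{End}^{\mathcal{C}}(\mathcal{C})$ (resp. ${}^{\mathcal{C}}\mathrm{End}(\mathcal{C})$) be the set of right (resp. left) $A$-linear, right (resp. left) $\mathcal{C}$-colinear endomorphisms of $\mathcal{C}$. For subgroups $X,Y\subseteq\mathcal{C}$ define the internal coproducts $$(X:_{\mathcal{C}^r}Y):=\bigcap\{f^{-1}(Y)\mid f\in\mathrm{End}^{\mathcal{C}}(\mathcal{C}),\ f(X)=0\},\qquad (X:_{\mathcal{C}^l}Y):=\bigcap\{f^{-1}(Y)\mid f\in{}^{\mathcal{C}}\mathrm{End}(\mathcal{C}),\ f(X)=0\},$$ and the wedge product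 $$K\wedge L:=\Delta^{-1}\bigl(\mathrm{Im}(K\otimes_A\mathcal{C})+\mathrm{Im}(\mathcal{C}\otimes_A L)\bigr).$$ 1. If ${}_A\mathcal{C}$ is flat, $K,L$ are right $\mathcal{C}$-coideals and ${}_AL\subseteq{}_A\mathcal{C}$ is pure, then $(K:_{\mathcal{C}^r}L)=K\wedge L$. 2. If $\mathcal{C}_A$ is flat, $K,L$ are left $\mathcal{C}$-coideals and $K_A\subseteq\mathcal{C}_A$ is pure, then $(L:_{\mathcal{C}^l}K)=K\wedge L$. 3. If ${}_A\mathcal{C}$ and $\mathcal{C}_A$ are flat, $K,L$ are $\mathcal{C}$-bicoideals, and ${}_AL\subseteq{}_A\mathcal{C}$ and $K_A\subseteq\mathcal{C}_A$ are pure, then $$(K:_{\mathcal{C}^r}L)=K\wedge L=(L:_{\mathcal{C}^l}K).$$ -/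

import Mathlib

open MulOpposite
open scoped TensorProduct

universe u v

/-!  Conventions: `A` is an arbitrary (not necessarily commutative) ring.  A right `A`-module is a
module over `Aᵐᵒᵖ`, so `op a • x` is what is usually written `x a`.  An `(A, A)`-bimodule carries
both structures, with commuting actions. -/

section Balanced

/-- The subgroup of `X ⊗[ℤ] Y` generated by the elements `x a ⊗ y - x ⊗ a y`. -/
def balancedRel (A : Type*) [Ring A] (X Y : Type*) [AddCommGroup X] [AddCommGroup Y]
    [Module Aᵐᵒᵖ X] [Module A Y] : AddSubgroup (X ⊗[ℤ] Y) :=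
  AddSubgroup.closure {t | ∃ (x : X) (a : A) (y : Y), t = (op a • x) ⊗ₜ[ℤ] y - x ⊗ₜ[ℤ] (a • y)}

/-- The tensor product `X ⊗_A Y` of a right `A`-module `X` and a left `A`-module `Y`. -/
def BalTensor (A : Type*) [Ring A] (X Y : Type*) [AddCommGroup X] [AddCommGroup Y]
    [Module Aᵐᵒᵖ X] [Module A Y] :=
  (X ⊗[ℤ] Y) ⧸ balancedRel A X Y

namespace BalTensor

variable {A : Type*} [Ring A] {X Y Z X' Y' P : Type*}
  [AddCommGroup X] [AddCommGroup Y] [AddCommGroup Z] [AddCommGroup X'] [AddCommGroup Y']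
  [AddCommGroup P] [Module Aᵐᵒᵖ X] [Module A Y] [Module Aᵐᵒᵖ X'] [Module A Y']

instance : AddCommGroup (BalTensor A X Y) :=
  inferInstanceAs (AddCommGroup ((X ⊗[ℤ] Y) ⧸ balancedRel A X Y))

/-- The pure tensor `x ⊗ y`. -/
def tmul (A : Type*) [Ring A] {X Y : Type*} [AddCommGroup X] [AddCommGroup Y]
    [Module Aᵐᵒᵖ X] [Module A Y] (x : X) (y : Y) : BalTensor A X Y :=
  QuotientAddGroup.mk' (balancedRel A X Y) (x ⊗ₜ[ℤ] y)

theorem add_tmul (x x' : X) (y : Y) : tmul A (x + x') y = tmul A x y + tmul A x' y := by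
  unfold tmul
  rw [TensorProduct.add_tmul]
  exact map_add (QuotientAddGroup.mk' (balancedRel A X Y)) _ _

theorem tmul_add (x : X) (y y' : Y) : tmul A x (y + y') = tmul A x y + tmul A x y' := by
  unfold tmul
  rw [TensorProduct.tmul_add]
  exact map_add (QuotientAddGroup.mk' (balancedRel A X Y)) _ _

theorem smul_tmul (x : X) (a : A) (y : Y) : tmul A (op a • x) y = tmul A x (a • y) := by
  refine QuotientAddGroup.eq_iff_sub_mem.2 ?_
  exact AddSubgroup.subset_closure ⟨x, a, y, rfl⟩

/-- A balanced biadditive map `X × Y → P` induces an additive map `X ⊗_A Y → P`. -/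
def lift (f : X →+ Y →+ P) (hf : ∀ x (a : A) y, f (op a • x) y = f x (a • y)) :
    BalTensor A X Y →+ P :=
  QuotientAddGroup.lift (balancedRel A X Y)
    (TensorProduct.liftAddHom (R := ℤ) f (fun r m n => by simp))
    ((AddSubgroup.closure_le _).2 (by
      rintro _ ⟨x, a, y, rfl⟩
      simp [hf]))

@[simp] theorem lift_tmul (f : X →+ Y →+ P)
    (hf : ∀ x (a : A) y, f (op a • x) y = f x (a • y)) (x : X) (y : Y) :
    lift f hf (tmul A x y) = f x y := rfl

@[elab_as_elim]
theorem induction_on {p : BalTensor A X Y → Prop} (t : BalTensor A X Y)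
    (htmul : ∀ x y, p (tmul A x y)) (hadd : ∀ s t, p s → p t → p (s + t)) : p t := by
  obtain ⟨t, rfl⟩ := QuotientAddGroup.mk'_surjective (balancedRel A X Y) t
  induction t using TensorProduct.induction_on with
  | zero => simpa [tmul] using htmul 0 0
  | tmul x y => exact htmul x y
  | add s t hs ht =>
    rw [map_add]
    exact hadd _ _ hs ht

/-- `f ⊗ g` for a right linear map `f` and a left linear map `g`. -/
def map (f : X →ₗ[Aᵐᵒᵖ] X') (g : Y →ₗ[A] Y') : BalTensor A X Y →+ BalTensor A X' Y' :=
  lift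
    (AddMonoidHom.mk' (fun x => AddMonoidHom.mk' (fun y => tmul A (f x) (g y))
        (fun y y' => by rw [map_add, tmul_add]))
      (fun x x' => by ext y; simp [add_tmul]))
    (fun x a y => by simp [smul_tmul])

@[simp] theorem map_tmul (f : X →ₗ[Aᵐᵒᵖ] X') (g : Y →ₗ[A] Y') (x : X) (y : Y) :
    map f g (tmul A x y) = tmul A (f x) (g y) := rfl

/-- Left multiplication by `a` on a bimodule, as a right linear map. -/
def leftMul (X : Type*) [AddCommGroup X] [Module Aᵐᵒᵖ X] [Module A X] [SMulCommClass A Aᵐᵒᵖ X]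
    (a : A) : X →ₗ[Aᵐᵒᵖ] X where
  toFun x := a • x
  map_add' := smul_add a
  map_smul' b x := smul_comm a b x

/-- Right multiplication by `b` on a bimodule, as a left linear map. -/
def rightMul (Y : Type*) [AddCommGroup Y] [Module Aᵐᵒᵖ Y] [Module A Y] [SMulCommClass A Aᵐᵒᵖ Y]
    (b : Aᵐᵒᵖ) : Y →ₗ[A] Y where
  toFun y := b • y
  map_add' := smul_add b
  map_smul' a y := (smul_comm a b y).symm

/-- If `X` is a bimodule, `X ⊗_A Y` is a left module with `a (x ⊗ y) = a x ⊗ y`. -/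
instance instModuleLeft [Module A X] [SMulCommClass A Aᵐᵒᵖ X] : Module A (BalTensor A X Y) where
  smul a t := map (leftMul X a) LinearMap.id t
  one_smul t := by
    change map (leftMul X (1 : A)) LinearMap.id t = t
    induction t using induction_on with
    | htmul x y => simp [leftMul]
    | hadd s t hs ht => rw [map_add, hs, ht]
  mul_smul a b t := by
    change map (leftMul X (a * b)) LinearMap.id t
      = map (leftMul X a) LinearMap.id (map (leftMul X b) LinearMap.id t)
    induction t using induction_on with
    | htmul x y => simp [leftMul, mul_smul]
    | hadd s t hs ht => rw [map_add, map_add, map_add, hs, ht]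
  smul_zero a := map_zero (map (leftMul X a) LinearMap.id)
  smul_add a := map_add (map (leftMul X a) LinearMap.id)
  add_smul a b t := by
    change map (leftMul X (a + b)) LinearMap.id t
      = map (leftMul X a) LinearMap.id t + map (leftMul X b) LinearMap.id t
    induction t using induction_on with
    | htmul x y => simp [leftMul, add_smul, add_tmul]
    | hadd s t hs ht => rw [map_add, map_add, map_add, hs, ht]; abel
  zero_smul t := by
    change map (leftMul X (0 : A)) LinearMap.id t = 0
    induction t using induction_on with
    | htmul x y => simpa [leftMul] using (add_tmul (A := A) (0 : X) 0 y)
    | hadd s t hs ht => rw [map_add, hs, ht, add_zero]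

/-- If `Y` is a bimodule, `X ⊗_A Y` is a right module with `(x ⊗ y) a = x ⊗ y a`. -/
instance instModuleRight [Module Aᵐᵒᵖ Y] [SMulCommClass A Aᵐᵒᵖ Y] :
    Module Aᵐᵒᵖ (BalTensor A X Y) where
  smul b t := map LinearMap.id (rightMul Y b) t
  one_smul t := by
    change map LinearMap.id (rightMul Y (1 : Aᵐᵒᵖ)) t = t
    induction t using induction_on with
    | htmul x y => simp [rightMul]
    | hadd s t hs ht => rw [map_add, hs, ht]
  mul_smul a b t := by
    change map LinearMap.id (rightMul Y (a * b)) t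
      = map LinearMap.id (rightMul Y a) (map LinearMap.id (rightMul Y b) t)
    induction t using induction_on with
    | htmul x y => simp [rightMul, mul_smul]
    | hadd s t hs ht => rw [map_add, map_add, map_add, hs, ht]
  smul_zero b := map_zero (map LinearMap.id (rightMul Y b))
  smul_add b := map_add (map LinearMap.id (rightMul Y b))
  add_smul a b t := by
    change map LinearMap.id (rightMul Y (a + b)) t
      = map LinearMap.id (rightMul Y a) t + map LinearMap.id (rightMul Y b) t
    induction t using induction_on with
    | htmul x y => simp [rightMul, add_smul, tmul_add]
    | hadd s t hs ht => rw [map_add, map_add, map_add, hs, ht]; abel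
  zero_smul t := by
    change map LinearMap.id (rightMul Y (0 : Aᵐᵒᵖ)) t = 0
    induction t using induction_on with
    | htmul x y => simpa [rightMul] using (tmul_add (A := A) x (0 : Y) 0)
    | hadd s t hs ht => rw [map_add, hs, ht, add_zero]

theorem smul_tmul_left [Module A X] [SMulCommClass A Aᵐᵒᵖ X] (a : A) (x : X) (y : Y) :
    a • tmul A x y = tmul A (a • x) y := rfl

theorem smul_tmul_right [Module Aᵐᵒᵖ Y] [SMulCommClass A Aᵐᵒᵖ Y] (b : Aᵐᵒᵖ) (x : X) (y : Y) :
    b • tmul A x y = tmul A x (b • y) := rfl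

instance [Module A X] [SMulCommClass A Aᵐᵒᵖ X] [Module Aᵐᵒᵖ Y] [SMulCommClass A Aᵐᵒᵖ Y] :
    SMulCommClass A Aᵐᵒᵖ (BalTensor A X Y) where
  smul_comm a b t := by
    induction t using induction_on with
    | htmul x y => simp only [smul_tmul_left, smul_tmul_right]
    | hadd s t hs ht => simp only [smul_add, hs, ht]

/-- The left linear map `Y → Y ⊗_A Z`, `y ↦ y ⊗ z`, for a bimodule `Y`. -/
def tmulRight [Module Aᵐᵒᵖ Y] [SMulCommClass A Aᵐᵒᵖ Y] [Module A Z] (z : Z) :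
    Y →ₗ[A] BalTensor A Y Z where
  toFun y := tmul A y z
  map_add' y y' := add_tmul y y' z
  map_smul' _ _ := rfl

/-- The canonical map `(X ⊗_A Y) ⊗_A Z → X ⊗_A (Y ⊗_A Z)`, `(x ⊗ y) ⊗ z ↦ x ⊗ (y ⊗ z)`
(an isomorphism), for a right module `X`, a bimodule `Y` and a left module `Z`. -/
def assoc (A : Type*) [Ring A] (X Y Z : Type*) [AddCommGroup X] [AddCommGroup Y] [AddCommGroup Z]
    [Module Aᵐᵒᵖ X] [Module A Y] [Module Aᵐᵒᵖ Y] [SMulCommClass A Aᵐᵒᵖ Y] [Module A Z] :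
    BalTensor A (BalTensor A X Y) Z →+ BalTensor A X (BalTensor A Y Z) :=
  lift
    (AddMonoidHom.mk' (fun t => AddMonoidHom.mk' (fun z => map LinearMap.id (tmulRight z) t)
        (fun z z' => by
          induction t using induction_on with
          | htmul x y =>
            change tmul A x (tmul A y (z + z')) = tmul A x (tmul A y z) + tmul A x (tmul A y z')
            rw [tmul_add, tmul_add]
          | hadd s t hs ht => rw [map_add, map_add, map_add, hs, ht]; abel))
      (fun s t => by ext z; exact map_add (map LinearMap.id (tmulRight z)) s t))
    (fun t a z => by
      change map LinearMap.id (tmulRight z) (op a • t) = map LinearMap.id (tmulRight (a • z)) t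
      induction t using induction_on with
      | htmul x y =>
        change tmul A x (tmul A (op a • y) z) = tmul A x (tmul A y (a • z))
        rw [smul_tmul]
      | hadd s t hs ht => rw [smul_add, map_add, map_add, hs, ht])

@[simp] theorem assoc_tmul [Module Aᵐᵒᵖ Y] [SMulCommClass A Aᵐᵒᵖ Y] [Module A Z]
    (x : X) (y : Y) (z : Z) :
    assoc A X Y Z (tmul A (tmul A x y) z) = tmul A x (tmul A y z) := rfl

/-- The map `X ⊗_A C → X`, `x ⊗ c ↦ x ε(c)`, for a left linear `ε : C → A`. -/
def rightContract (ε : Y →ₗ[A] A) : BalTensor A X Y →+ X :=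
  lift
    (AddMonoidHom.mk' (fun x => AddMonoidHom.mk' (fun y => op (ε y) • x)
        (fun y y' => by rw [map_add, op_add, add_smul]))
      (fun x x' => by ext y; simp))
    (fun x a y => by simp [mul_smul])

/-- The map `C ⊗_A Y → Y`, `c ⊗ y ↦ ε(c) y`, for a right linear `ε : C → A`. -/
def leftContract (ε : X →ₗ[Aᵐᵒᵖ] A) : BalTensor A X Y →+ Y :=
  lift
    (AddMonoidHom.mk' (fun x => AddMonoidHom.mk' (fun y => ε x • y)
        (fun y y' => by rw [smul_add]))
      (fun x x' => by ext y; simp [add_smul]))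
    (fun x a y => by simp [mul_smul])

end BalTensor

end Balanced

open BalTensor

/-- Homomorphisms of `(A, A)`-bimodules. -/
structure BimoduleHom (A : Type*) [Ring A] (M N : Type*) [AddCommGroup M] [AddCommGroup N]
    [Module A M] [Module Aᵐᵒᵖ M] [Module A N] [Module Aᵐᵒᵖ N] extends M →+ N where
  map_smul' : ∀ (a : A) (m : M), toFun (a • m) = a • toFun m
  map_op_smul' : ∀ (b : Aᵐᵒᵖ) (m : M), toFun (b • m) = b • toFun m

namespace BimoduleHom

variable {A : Type*} [Ring A] {M N : Type*} [AddCommGroup M] [AddCommGroup N]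
    [Module A M] [Module Aᵐᵒᵖ M] [Module A N] [Module Aᵐᵒᵖ N]

/-- The underlying left linear map. -/
def left (f : BimoduleHom A M N) : M →ₗ[A] N where
  toFun := f.toFun
  map_add' := f.map_add'
  map_smul' := f.map_smul'

/-- The underlying right linear map. -/
def right (f : BimoduleHom A M N) : M →ₗ[Aᵐᵒᵖ] N where
  toFun := f.toFun
  map_add' := f.map_add'
  map_smul' := f.map_op_smul'

end BimoduleHom

/-- `A`-corings: `(A, A)`-bimodules `C` with a bilinear coassociative comultiplication
`C → C ⊗_A C` and a bilinear counit `C → A`. -/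
class Coring (A : Type*) [Ring A] (C : Type*) [AddCommGroup C] [Module A C] [Module Aᵐᵒᵖ C]
    [SMulCommClass A Aᵐᵒᵖ C] where
  comul : BimoduleHom A C (BalTensor A C C)
  counit : BimoduleHom A C A
  coassoc : ∀ c, assoc A C C C (map comul.right LinearMap.id (comul.toFun c)) =
    map LinearMap.id comul.left (comul.toFun c)
  right_counit : ∀ c, rightContract counit.left (comul.toFun c) = c
  left_counit : ∀ c, leftContract counit.right (comul.toFun c) = c

section Comodules

variable (A : Type*) [Ring A] (C : Type*) [AddCommGroup C] [Module A C] [Module Aᵐᵒᵖ C]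
    [SMulCommClass A Aᵐᵒᵖ C] [Coring A C]

/-- Right `C`-comodule structures on a right `A`-module `M`. -/
structure RightComodule (M : Type*) [AddCommGroup M] [Module Aᵐᵒᵖ M] where
  coact : M →ₗ[Aᵐᵒᵖ] BalTensor A M C
  coassoc : ∀ m, assoc A M C C (map coact LinearMap.id (coact m)) =
    map LinearMap.id (Coring.comul (A := A) (C := C)).left (coact m)
  counit : ∀ m, rightContract (Coring.counit (A := A) (C := C)).left (coact m) = m

/-- Left `C`-comodule structures on a left `A`-module `M`. -/
structure LeftComodule (M : Type*) [AddCommGroup M] [Module A M] where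
  coact : M →ₗ[A] BalTensor A C M
  coassoc : ∀ m, assoc A C C M (map (Coring.comul (A := A) (C := C)).right LinearMap.id (coact m)) =
    map LinearMap.id coact (coact m)
  counit : ∀ m, leftContract (Coring.counit (A := A) (C := C)).right (coact m) = m

/-- `(C, C)`-bicomodule structures on an `(A, A)`-bimodule `M`: bilinear left and right
coactions that commute. -/
structure Bicomodule (M : Type*) [AddCommGroup M] [Module A M] [Module Aᵐᵒᵖ M]
    [SMulCommClass A Aᵐᵒᵖ M] where
  rightCoact : BimoduleHom A M (BalTensor A M C)
  leftCoact : BimoduleHom A M (BalTensor A C M)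
  right_coassoc : ∀ m, assoc A M C C (map rightCoact.right LinearMap.id (rightCoact.toFun m)) =
    map LinearMap.id (Coring.comul (A := A) (C := C)).left (rightCoact.toFun m)
  right_counit : ∀ m,
    rightContract (Coring.counit (A := A) (C := C)).left (rightCoact.toFun m) = m
  left_coassoc : ∀ m,
    assoc A C C M (map (Coring.comul (A := A) (C := C)).right LinearMap.id (leftCoact.toFun m)) =
    map LinearMap.id leftCoact.left (leftCoact.toFun m)
  left_counit : ∀ m,
    leftContract (Coring.counit (A := A) (C := C)).right (leftCoact.toFun m) = m
  compat : ∀ m, assoc A C M C (map leftCoact.right LinearMap.id (rightCoact.toFun m)) =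
    map LinearMap.id rightCoact.left (leftCoact.toFun m)

/-- `C` as a right comodule over itself. -/
def Coring.rightRegular : RightComodule A C C where
  coact := (Coring.comul (A := A) (C := C)).right
  coassoc := Coring.coassoc
  counit := Coring.right_counit

/-- `C` as a left comodule over itself. -/
def Coring.leftRegular : LeftComodule A C C where
  coact := (Coring.comul (A := A) (C := C)).left
  coassoc := Coring.coassoc
  counit := Coring.left_counit

variable {A C}

/-- Colinearity of a right `A`-linear endomorphism of a right comodule. -/
def RightComodule.IsColinear {M : Type*} [AddCommGroup M] [Module Aᵐᵒᵖ M]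
    (S : RightComodule A C M) (f : M →ₗ[Aᵐᵒᵖ] M) : Prop :=
  ∀ m, S.coact (f m) = map f LinearMap.id (S.coact m)

/-- Colinearity of a left `A`-linear endomorphism of a left comodule. -/
def LeftComodule.IsColinear {M : Type*} [AddCommGroup M] [Module A M]
    (S : LeftComodule A C M) (f : M →ₗ[A] M) : Prop :=
  ∀ m, S.coact (f m) = map LinearMap.id f (S.coact m)

/-- The internal coproduct `(X :_M Y) = ⋂ {f⁻¹(Y) ∣ f ∈ End^C(M), f(X) = 0}` for a right
comodule `M`. -/
def RightComodule.internalCoproduct {M : Type*} [AddCommGroup M] [Module Aᵐᵒᵖ M]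
    (S : RightComodule A C M) (X Y : AddSubgroup M) : AddSubgroup M where
  carrier := {m | ∀ f : M →ₗ[Aᵐᵒᵖ] M, S.IsColinear f → (∀ x ∈ X, f x = 0) → f m ∈ Y}
  zero_mem' f _ _ := by rw [map_zero]; exact Y.zero_mem
  add_mem' hm hn f hf h0 := by rw [map_add]; exact Y.add_mem (hm f hf h0) (hn f hf h0)
  neg_mem' hm f hf h0 := by rw [map_neg]; exact Y.neg_mem (hm f hf h0)

/-- The internal coproduct `(X :_M Y) = ⋂ {f⁻¹(Y) ∣ f ∈ ^C End(M), f(X) = 0}` for a left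
comodule `M`. -/
def LeftComodule.internalCoproduct {M : Type*} [AddCommGroup M] [Module A M]
    (S : LeftComodule A C M) (X Y : AddSubgroup M) : AddSubgroup M where
  carrier := {m | ∀ f : M →ₗ[A] M, S.IsColinear f → (∀ x ∈ X, f x = 0) → f m ∈ Y}
  zero_mem' f _ _ := by rw [map_zero]; exact Y.zero_mem
  add_mem' hm hn f hf h0 := by rw [map_add]; exact Y.add_mem (hm f hf h0) (hn f hf h0)
  neg_mem' hm f hf h0 := by rw [map_neg]; exact Y.neg_mem (hm f hf h0)

/-- `(K :_{C^r} L)`: the internal coproduct in the right comodule `C`. -/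
def internalCoproductRight (A : Type*) [Ring A] {C : Type*} [AddCommGroup C] [Module A C]
    [Module Aᵐᵒᵖ C] [SMulCommClass A Aᵐᵒᵖ C] [Coring A C] (K L : AddSubgroup C) : AddSubgroup C :=
  (Coring.rightRegular A C).internalCoproduct K L

/-- `(K :_{C^l} L)`: the internal coproduct in the left comodule `C`. -/
def internalCoproductLeft (A : Type*) [Ring A] {C : Type*} [AddCommGroup C] [Module A C]
    [Module Aᵐᵒᵖ C] [SMulCommClass A Aᵐᵒᵖ C] [Coring A C] (K L : AddSubgroup C) : AddSubgroup C :=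
  (Coring.leftRegular A C).internalCoproduct K L

/-- The wedge product `K ∧ L = Δ⁻¹(Im(K ⊗_A C) + Im(C ⊗_A L))` of a right `A`-submodule `K` and a
left `A`-submodule `L` of a coring. -/
def wedge (K : Submodule Aᵐᵒᵖ C) (L : Submodule A C) : AddSubgroup C :=
  ((map K.subtype (LinearMap.id : C →ₗ[A] C)).range ⊔
    (map (LinearMap.id : C →ₗ[Aᵐᵒᵖ] C) L.subtype).range).comap
      (Coring.comul (A := A) (C := C)).toAddMonoidHom

/-- Right coideals: right `A`-submodules of `C` that are right `C`-comodules with the restriction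
of the comultiplication as coaction. -/
def IsRightCoideal (K : Submodule Aᵐᵒᵖ C) : Prop :=
  ∃ S : RightComodule A C K, ∀ k : K,
    map K.subtype (LinearMap.id : C →ₗ[A] C) (S.coact k) = Coring.comul.toFun (k : C)

/-- Left coideals: left `A`-submodules of `C` that are left `C`-comodules with the restriction
of the comultiplication as coaction. -/
def IsLeftCoideal (K : Submodule A C) : Prop :=
  ∃ S : LeftComodule A C K, ∀ k : K,
    map (LinearMap.id : C →ₗ[Aᵐᵒᵖ] C) K.subtype (S.coact k) = Coring.comul.toFun (k : C)

end Comodules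

/-- `(A, A)`-subbimodules of a bimodule. -/
structure SubBimodule (A : Type*) [Ring A] (M : Type*) [AddCommGroup M] [Module A M]
    [Module Aᵐᵒᵖ M] where
  /-- the underlying left submodule -/
  left : Submodule A M
  op_smul_mem : ∀ (b : Aᵐᵒᵖ) {m : M}, m ∈ left → b • m ∈ left

namespace SubBimodule

variable {A : Type*} [Ring A] {M : Type*} [AddCommGroup M] [Module A M] [Module Aᵐᵒᵖ M]

/-- The underlying right submodule. -/
def right (B : SubBimodule A M) : Submodule Aᵐᵒᵖ M where
  carrier := B.left
  add_mem' := B.left.add_mem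
  zero_mem' := B.left.zero_mem
  smul_mem' b _ hm := B.op_smul_mem b hm

/-- The underlying additive subgroup. -/
def toAddSubgroup (B : SubBimodule A M) : AddSubgroup M := B.left.toAddSubgroup

/-- A subbimodule is a right module. -/
instance (B : SubBimodule A M) : Module Aᵐᵒᵖ B.left := inferInstanceAs (Module Aᵐᵒᵖ B.right)

instance [SMulCommClass A Aᵐᵒᵖ M] (B : SubBimodule A M) : SMulCommClass A Aᵐᵒᵖ B.left where
  smul_comm a b m := Subtype.ext (smul_comm a b (m : M))

/-- The inclusion of a subbimodule, as a right linear map. -/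
def rightSubtype (B : SubBimodule A M) : B.left →ₗ[Aᵐᵒᵖ] M where
  toFun m := m
  map_add' _ _ := rfl
  map_smul' _ _ := rfl

end SubBimodule

/-- Bicoideals: subbimodules of `C` that are `(C, C)`-bicomodules with the restrictions of the
comultiplication as coactions. -/
def IsBicoideal {A : Type*} [Ring A] {C : Type*} [AddCommGroup C] [Module A C] [Module Aᵐᵒᵖ C]
    [SMulCommClass A Aᵐᵒᵖ C] [Coring A C] (B : SubBimodule A C) : Prop :=
  ∃ S : Bicomodule A C B.left,
    (∀ b : B.left, map B.rightSubtype (LinearMap.id : C →ₗ[A] C) (S.rightCoact.toFun b) =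
      Coring.comul.toFun (b : C)) ∧
    (∀ b : B.left, map (LinearMap.id : C →ₗ[Aᵐᵒᵖ] C) B.left.subtype (S.leftCoact.toFun b) =
      Coring.comul.toFun (b : C))

/-- Flatness of a left `A`-module `N`: `- ⊗_A N` preserves injectivity. -/
def IsFlatLeft (A : Type u) [Ring A] (N : Type v) [AddCommGroup N] [Module A N] : Prop :=
  ∀ (X Y : Type (max u v)) [AddCommGroup X] [AddCommGroup Y] [Module Aᵐᵒᵖ X] [Module Aᵐᵒᵖ Y]
    (f : X →ₗ[Aᵐᵒᵖ] Y), Function.Injective f →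
      Function.Injective (map f (LinearMap.id : N →ₗ[A] N))

/-- Flatness of a right `A`-module `N`: `N ⊗_A -` preserves injectivity. -/
def IsFlatRight (A : Type u) [Ring A] (N : Type v) [AddCommGroup N] [Module Aᵐᵒᵖ N] : Prop :=
  ∀ (X Y : Type (max u v)) [AddCommGroup X] [AddCommGroup Y] [Module A X] [Module A Y]
    (f : X →ₗ[A] Y), Function.Injective f →
      Function.Injective (map (LinearMap.id : N →ₗ[Aᵐᵒᵖ] N) f)

/-- Purity of a left submodule `L ⊆ M`: `X ⊗_A L → X ⊗_A M` is injective for all right modules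
`X`. -/
def IsPureLeft {A : Type u} [Ring A] {M : Type v} [AddCommGroup M] [Module A M]
    (L : Submodule A M) : Prop :=
  ∀ (X : Type (max u v)) [AddCommGroup X] [Module Aᵐᵒᵖ X],
    Function.Injective (map (LinearMap.id : X →ₗ[Aᵐᵒᵖ] X) L.subtype)

/-- Purity of a right submodule `K ⊆ M`: `K ⊗_A X → M ⊗_A X` is injective for all left modules
`X`. -/
def IsPureRight {A : Type u} [Ring A] {M : Type v} [AddCommGroup M] [Module Aᵐᵒᵖ M]
    (K : Submodule Aᵐᵒᵖ M) : Prop :=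
  ∀ (X : Type (max u v)) [AddCommGroup X] [Module A X],
    Function.Injective (map K.subtype (LinearMap.id : X →ₗ[A] X))

/-- Quasi-Frobenius rings: Noetherian and self-injective on both sides. -/
structure IsQuasiFrobenius (A : Type*) [Ring A] : Prop where
  left_noetherian : IsNoetherian A A
  right_noetherian : IsNoetherian Aᵐᵒᵖ A
  left_injective : Module.Injective A A
  right_injective : Module.Injective Aᵐᵒᵖ A

/-! ### Extending maps into an injective module. -/

section Injective

/-! Right colinear endomorphisms of `C` come from right linear forms. A form `φ` gives the colinear
map `c ↦ φ(c₁) c₂` (`endRight`), and the counit shows that every colinear `f` arises this way from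
`ε ∘ f`. If `Δ(K) ⊆ Im(K ⊗ C)`, a form vanishing on `K` gives an endomorphism vanishing on `K`;
conversely, `f(K) = 0` implies `(ε ∘ f)(K) = 0`. So `c` lies in the internal coproduct iff `(φ ⊗
id)Δ(c) ∈ L` for every form `φ` on `C/K`. By right exactness of the tensor product, `c` lies in the
wedge iff the image of `Δ(c)` in `C/K ⊗ C` comes from `C/K ⊗ L`.

It remains to see that forms on a right module `X` detect whether `z = ∑ xᵢ ⊗ yᵢ` comes from `X ⊗ L`
(`IsQuasiFrobenius.mem_range_of_leftContract`). Over a quasi-Frobenius ring the relations `∑ xᵢ rᵢ =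
0` are cut out by finitely many equations `Pⱼ · r = 0`, because finitely generated submodules of
`Aᵐ` equal their double annihilators. Self-injectivity provides forms `φⱼ` on `X` with `φⱼ(xᵢ) =
Pⱼᵢ`, so the hypothesis on `z` says `∑ᵢ Pⱼᵢ yᵢ ∈ L` for all `j`. Purity replaces the `yᵢ` by `lᵢ ∈
L` with the same values, and flatness gives `∑ xᵢ ⊗ (yᵢ - lᵢ) = 0`.

The left-handed statement is the mirror image, and bicoideals satisfy the inclusions needed on both
sides. -/

theorem Module.Baer.exists_comp_eq {R Q M N : Type*} [Ring R] [AddCommGroup Q] [AddCommGroup M]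
    [AddCommGroup N] [Module R Q] [Module R M] [Module R N] (h : Module.Baer R Q)
    (f : M →ₗ[R] N) (g : M →ₗ[R] Q) (hfg : ∀ m, f m = 0 → g m = 0) :
    ∃ φ : N →ₗ[R] Q, ∀ m, φ (f m) = g m := by
  -- `f` embeds `M / ker f` in `N`, and `g` factors through `M / ker f`.
  obtain ⟨φ, hφ⟩ := h.extension_property ((LinearMap.ker f).liftQ f le_rfl)
    (LinearMap.ker_eq_bot.1 (Submodule.ker_liftQ_eq_bot _ _ _ le_rfl))
    ((LinearMap.ker f).liftQ g hfg)
  exact ⟨φ, fun m => LinearMap.congr_fun hφ (Submodule.Quotient.mk m)⟩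

end Injective

/-! ### Linear maps on `Aᵐ` given by coefficient vectors. -/

section DotProduct

variable {A : Type*} [Ring A] {m : ℕ}

/-- The left linear map `a ↦ ∑ aᵢ xᵢ`. -/
def dotLeft (x : Fin m → A) : (Fin m → A) →ₗ[A] A where
  toFun a := a ⬝ᵥ x
  map_add' a b := add_dotProduct a b x
  map_smul' c a := smul_dotProduct c a x

/-- The right linear map `x ↦ ∑ aᵢ xᵢ`. -/
def dotRight (a : Fin m → A) : (Fin m → A) →ₗ[Aᵐᵒᵖ] A where
  toFun x := a ⬝ᵥ x
  map_add' x y := dotProduct_add a x y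
  map_smul' c x := dotProduct_smul c a x

/-- The right linear map `r ↦ ∑ xᵢ rᵢ`. -/
def combRight {X : Type*} [AddCommGroup X] [Module Aᵐᵒᵖ X] (x : Fin m → X) :
    (Fin m → A) →ₗ[Aᵐᵒᵖ] X where
  toFun r := ∑ i, op (r i) • x i
  map_add' r s := by simp [add_smul, Finset.sum_add_distrib]
  map_smul' c r := by simp [Finset.smul_sum, mul_smul]

/-- The left linear map `r ↦ ∑ rᵢ xᵢ`. -/
def combLeft {X : Type*} [AddCommGroup X] [Module A X] (x : Fin m → X) :
    (Fin m → A) →ₗ[A] X where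
  toFun r := ∑ i, r i • x i
  map_add' r s := by simp [add_smul, Finset.sum_add_distrib]
  map_smul' c r := by simp [Finset.smul_sum, mul_smul]

end DotProduct

/-! ### Double annihilators in `Aᵐ`. -/

section DoubleAnnihilator

variable {A : Type*} [Ring A] {m : ℕ}

/-- Over a left self-injective ring, finitely generated right submodules of `Aᵐ` are closed under
double annihilators. -/
theorem mem_of_forall_dotProduct_eq_zero_right (hA : Module.Baer A A)
    {R : Submodule Aᵐᵒᵖ (Fin m → A)} (hR : R.FG) {x : Fin m → A}
    (hx : ∀ a : Fin m → A, (∀ r ∈ R, a ⬝ᵥ r = 0) → a ⬝ᵥ x = 0) : x ∈ R := by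
  obtain ⟨k, b, rfl⟩ := Submodule.fg_iff_exists_fin_generating_family.1 hR
  -- The form `a ↦ a ⬝ᵥ x` vanishes wherever all `a ⬝ᵥ b t` vanish, so it is a left linear function
  -- `φ` of the tuple of these products.
  obtain ⟨φ, hφ⟩ := hA.exists_comp_eq (LinearMap.pi fun t => dotLeft (b t)) (dotLeft x)
    (fun a ha => hx a fun r hr => by
      induction hr using Submodule.span_induction with
      | mem r hr =>
        obtain ⟨t, rfl⟩ := hr
        exact congrFun ha t
      | zero => exact dotProduct_zero a
      | add r s _ _ hr hs => rw [dotProduct_add, hr, hs, add_zero]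
      | smul c r _ hr => rw [dotProduct_smul, hr, smul_zero])
  -- Evaluating at the unit vectors `a = eᵢ` exhibits `x` as a combination of the generators, with
  -- coefficients `φ(eₜ)` on the right.
  have key : x = ∑ t, op (φ (Pi.single t 1)) • b t := by
    ext i
    have h := hφ (Pi.single i 1)
    have h1 : dotLeft x (Pi.single i 1) = x i := single_one_dotProduct i x
    have h2 : (LinearMap.pi fun t => dotLeft (b t)) (Pi.single i 1) = fun t => b t i :=
      funext fun t => single_one_dotProduct i (b t)
    have h3 : (fun t => b t i) = ∑ t, b t i • (Pi.single t 1 : Fin k → A) := by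
      ext s
      simp [Finset.sum_apply, Pi.single_apply]
    rw [h1, h2, h3, map_sum] at h
    simp [← h]
  rw [key]
  exact Submodule.sum_mem _ fun t _ => Submodule.smul_mem _ _ (Submodule.subset_span ⟨t, rfl⟩)

/-- Over a right self-injective ring, finitely generated left submodules of `Aᵐ` are closed under
double annihilators. -/
theorem mem_of_forall_dotProduct_eq_zero_left (hA : Module.Baer Aᵐᵒᵖ A)
    {R : Submodule A (Fin m → A)} (hR : R.FG) {x : Fin m → A}
    (hx : ∀ a : Fin m → A, (∀ r ∈ R, r ⬝ᵥ a = 0) → x ⬝ᵥ a = 0) : x ∈ R := by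
  obtain ⟨k, b, rfl⟩ := Submodule.fg_iff_exists_fin_generating_family.1 hR
  obtain ⟨φ, hφ⟩ := hA.exists_comp_eq (LinearMap.pi fun t => dotRight (b t)) (dotRight x)
    (fun a ha => hx a fun r hr => by
      induction hr using Submodule.span_induction with
      | mem r hr =>
        obtain ⟨t, rfl⟩ := hr
        exact congrFun ha t
      | zero => exact zero_dotProduct a
      | add r s _ _ hr hs => rw [add_dotProduct, hr, hs, add_zero]
      | smul c r _ hr => rw [smul_dotProduct, hr, smul_zero])
  have key : x = ∑ t, φ (Pi.single t 1) • b t := by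
    ext i
    have h := hφ (Pi.single i 1)
    have h1 : dotRight x (Pi.single i 1) = x i := dotProduct_single_one x i
    have h2 : (LinearMap.pi fun t => dotRight (b t)) (Pi.single i 1) = fun t => b t i :=
      funext fun t => dotProduct_single_one (b t) i
    have h3 : (fun t => b t i) = ∑ t, op (b t i) • (Pi.single t 1 : Fin k → A) := by
      ext s
      simp [Finset.sum_apply, Pi.single_apply]
    rw [h1, h2, h3, map_sum] at h
    simp [← h]
  rw [key]
  exact Submodule.sum_mem _ fun t _ => Submodule.smul_mem _ _ (Submodule.subset_span ⟨t, rfl⟩)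

/-- Over a quasi-Frobenius ring, every right submodule of `Aᵐ` is the solution set of a finite
system of linear equations. -/
theorem IsQuasiFrobenius.exists_equations_right (hA : IsQuasiFrobenius A)
    (R : Submodule Aᵐᵒᵖ (Fin m → A)) :
    ∃ (n : ℕ) (P : Fin n → Fin m → A), ∀ r, r ∈ R ↔ ∀ j, P j ⬝ᵥ r = 0 := by
  have := hA.left_noetherian
  have := hA.right_noetherian
  -- `T` is the left annihilator of `R`. A finite generating set of `T` serves as the system of
  -- equations, and its solution set is the double annihilator of `R`.
  let T : Submodule A (Fin m → A) := ⨅ r : R, LinearMap.ker (dotLeft (r : Fin m → A))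
  have hT : ∀ a, a ∈ T ↔ ∀ r ∈ R, a ⬝ᵥ r = 0 := fun a => by
    simp only [T, Submodule.mem_iInf, Subtype.forall]; rfl
  obtain ⟨n, P, hP⟩ := Submodule.fg_iff_exists_fin_generating_family.1
    (IsNoetherian.noetherian T)
  refine ⟨n, P, fun r => ⟨fun hr j => (hT _).1 (hP ▸ Submodule.subset_span ⟨j, rfl⟩) r hr,
    fun hr => mem_of_forall_dotProduct_eq_zero_right (Module.Baer.of_injective hA.left_injective)
      (IsNoetherian.noetherian R) fun a ha => ?_⟩⟩
  have ha' : a ∈ Submodule.span A (Set.range P) := hP ▸ (hT a).2 ha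
  have hle : Submodule.span A (Set.range P) ≤ LinearMap.ker (dotLeft r) :=
    Submodule.span_le.2 (by rintro _ ⟨j, rfl⟩; exact hr j)
  exact hle ha'

/-- Over a quasi-Frobenius ring, every left submodule of `Aᵐ` is the solution set of a finite
system of linear equations. -/
theorem IsQuasiFrobenius.exists_equations_left (hA : IsQuasiFrobenius A)
    (R : Submodule A (Fin m → A)) :
    ∃ (n : ℕ) (P : Fin n → Fin m → A), ∀ r, r ∈ R ↔ ∀ j, r ⬝ᵥ P j = 0 := by
  have := hA.left_noetherian
  have := hA.right_noetherian
  let T : Submodule Aᵐᵒᵖ (Fin m → A) := ⨅ r : R, LinearMap.ker (dotRight (r : Fin m → A))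
  have hT : ∀ a, a ∈ T ↔ ∀ r ∈ R, r ⬝ᵥ a = 0 := fun a => by
    simp only [T, Submodule.mem_iInf, Subtype.forall]; rfl
  obtain ⟨n, P, hP⟩ := Submodule.fg_iff_exists_fin_generating_family.1
    (IsNoetherian.noetherian T)
  refine ⟨n, P, fun r => ⟨fun hr j => (hT _).1 (hP ▸ Submodule.subset_span ⟨j, rfl⟩) r hr,
    fun hr => mem_of_forall_dotProduct_eq_zero_left (Module.Baer.of_injective hA.right_injective)
      (IsNoetherian.noetherian R) fun a ha => ?_⟩⟩
  have ha' : a ∈ Submodule.span Aᵐᵒᵖ (Set.range P) := hP ▸ (hT a).2 ha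
  have hle : Submodule.span Aᵐᵒᵖ (Set.range P) ≤ LinearMap.ker (dotRight r) :=
    Submodule.span_le.2 (by rintro _ ⟨j, rfl⟩; exact hr j)
  exact hle ha'

end DoubleAnnihilator

/-! ### Finite sums of tensors and right exactness. -/

namespace BalTensor

section Exactness

variable {A : Type*} [Ring A] {X Y X' Y' : Type*}
  [AddCommGroup X] [AddCommGroup Y] [AddCommGroup X'] [AddCommGroup Y']
  [Module Aᵐᵒᵖ X] [Module A Y] [Module Aᵐᵒᵖ X'] [Module A Y']

theorem zero_tmul (y : Y) : tmul A (0 : X) y = 0 := by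
  simpa using add_tmul (A := A) (0 : X) 0 y

theorem tmul_zero (x : X) : tmul A x (0 : Y) = 0 := by
  simpa using tmul_add (A := A) x (0 : Y) 0

theorem sub_tmul (x x' : X) (y : Y) : tmul A (x - x') y = tmul A x y - tmul A x' y := by
  rw [eq_sub_iff_add_eq, ← add_tmul, sub_add_cancel]

theorem tmul_sub (x : X) (y y' : Y) : tmul A x (y - y') = tmul A x y - tmul A x y' := by
  rw [eq_sub_iff_add_eq, ← tmul_add, sub_add_cancel]

theorem sum_tmul {ι : Type*} (s : Finset ι) (x : ι → X) (y : Y) :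
    tmul A (∑ i ∈ s, x i) y = ∑ i ∈ s, tmul A (x i) y :=
  map_sum (AddMonoidHom.mk' (fun x : X => tmul A x y) fun x x' => add_tmul x x' y) x s

theorem tmul_sum {ι : Type*} (s : Finset ι) (x : X) (y : ι → Y) :
    tmul A x (∑ i ∈ s, y i) = ∑ i ∈ s, tmul A x (y i) :=
  map_sum (AddMonoidHom.mk' (fun y : Y => tmul A x y) fun y y' => tmul_add x y y') y s

theorem exists_eq_sum (t : BalTensor A X Y) :
    ∃ (m : ℕ) (x : Fin m → X) (y : Fin m → Y), t = ∑ i, tmul A (x i) (y i) := by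
  induction t using induction_on with
  | htmul x y => exact ⟨1, fun _ => x, fun _ => y, by simp⟩
  | hadd s t hs ht =>
    obtain ⟨m, x, y, rfl⟩ := hs
    obtain ⟨n, x', y', rfl⟩ := ht
    exact ⟨m + n, Fin.append x x', Fin.append y y', by simp [Fin.sum_univ_add]⟩

theorem map_comp_apply {X'' Y'' : Type*} [AddCommGroup X''] [AddCommGroup Y''] [Module Aᵐᵒᵖ X'']
    [Module A Y''] (f : X →ₗ[Aᵐᵒᵖ] X') (f' : X' →ₗ[Aᵐᵒᵖ] X'') (g : Y →ₗ[A] Y')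
    (g' : Y' →ₗ[A] Y'') (t : BalTensor A X Y) :
    map f' g' (map f g t) = map (f' ∘ₗ f) (g' ∘ₗ g) t := by
  induction t using induction_on with
  | htmul x y => rfl
  | hadd s t hs ht => simp only [map_add, hs, ht]

theorem map_surjective (f : X →ₗ[Aᵐᵒᵖ] X') (g : Y →ₗ[A] Y') (hf : Function.Surjective f)
    (hg : Function.Surjective g) : Function.Surjective (map f g) := by
  intro t
  induction t using induction_on with
  | htmul x y =>
    obtain ⟨x, rfl⟩ := hf x
    obtain ⟨y, rfl⟩ := hg y
    exact ⟨tmul A x y, rfl⟩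
  | hadd s t hs ht =>
    obtain ⟨s, rfl⟩ := hs
    obtain ⟨t, rfl⟩ := ht
    exact ⟨s + t, map_add _ _ _⟩

/-- Right exactness in the first variable. -/
theorem mem_range_of_map_mkQ_left_eq_zero (K : Submodule Aᵐᵒᵖ X) {t : BalTensor A X Y}
    (ht : map K.mkQ (LinearMap.id : Y →ₗ[A] Y) t = 0) :
    t ∈ (map K.subtype (LinearMap.id : Y →ₗ[A] Y)).range := by
  set R := (map K.subtype (LinearMap.id : Y →ₗ[A] Y)).range
  let f : X →+ Y →+ BalTensor A X Y ⧸ R :=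
    AddMonoidHom.mk' (fun x => AddMonoidHom.mk' (fun y => QuotientAddGroup.mk (tmul A x y))
      (fun y y' => by rw [tmul_add]; rfl)) (fun x x' => by ext y; simp [add_tmul])
  have hf : ∀ x ∈ K, f x = 0 := fun x hx => by
    ext y
    exact (QuotientAddGroup.eq_zero_iff _).2 ⟨tmul A ⟨x, hx⟩ y, rfl⟩
  let F : X ⧸ K →+ Y →+ BalTensor A X Y ⧸ R := QuotientAddGroup.lift K.toAddSubgroup f hf
  -- `G` factors the projection onto the cokernel `(X ⊗ Y)/R` through `X/K ⊗ Y`, so a tensor dying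
  -- in `X/K ⊗ Y` lies in `R`.
  let G : BalTensor A (X ⧸ K) Y →+ BalTensor A X Y ⧸ R := lift F (fun x a y => by
    obtain ⟨x, rfl⟩ := K.mkQ_surjective x
    change QuotientAddGroup.mk (tmul A (op a • x) y) = QuotientAddGroup.mk (tmul A x (a • y))
    rw [smul_tmul])
  have hG : ∀ t, G (map K.mkQ LinearMap.id t) = QuotientAddGroup.mk t := fun t => by
    induction t using induction_on with
    | htmul x y => rfl
    | hadd s t hs ht => rw [map_add, map_add, hs, ht]; rfl
  rw [← QuotientAddGroup.eq_zero_iff, ← hG, ht, map_zero]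

/-- Right exactness in the second variable. -/
theorem mem_range_of_map_mkQ_right_eq_zero (L : Submodule A Y) {t : BalTensor A X Y}
    (ht : map (LinearMap.id : X →ₗ[Aᵐᵒᵖ] X) L.mkQ t = 0) :
    t ∈ (map (LinearMap.id : X →ₗ[Aᵐᵒᵖ] X) L.subtype).range := by
  set R := (map (LinearMap.id : X →ₗ[Aᵐᵒᵖ] X) L.subtype).range
  -- The variables are swapped so that `f` descends to `Y ⧸ L` in its first argument; `F.flip`
  -- restores the order.
  let f : Y →+ X →+ BalTensor A X Y ⧸ R :=
    AddMonoidHom.mk' (fun y => AddMonoidHom.mk' (fun x => QuotientAddGroup.mk (tmul A x y))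
      (fun x x' => by rw [add_tmul]; rfl)) (fun y y' => by ext x; simp [tmul_add])
  have hf : ∀ y ∈ L, f y = 0 := fun y hy => by
    ext x
    exact (QuotientAddGroup.eq_zero_iff _).2 ⟨tmul A x ⟨y, hy⟩, rfl⟩
  let F : Y ⧸ L →+ X →+ BalTensor A X Y ⧸ R := QuotientAddGroup.lift L.toAddSubgroup f hf
  let G : BalTensor A X (Y ⧸ L) →+ BalTensor A X Y ⧸ R := lift F.flip (fun x a y => by
    obtain ⟨y, rfl⟩ := L.mkQ_surjective y
    change QuotientAddGroup.mk (tmul A (op a • x) y) = QuotientAddGroup.mk (tmul A x (a • y))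
    rw [smul_tmul])
  have hG : ∀ t, G (map LinearMap.id L.mkQ t) = QuotientAddGroup.mk t := fun t => by
    induction t using induction_on with
    | htmul x y => rfl
    | hadd s t hs ht => rw [map_add, map_add, hs, ht]; rfl
  rw [← QuotientAddGroup.eq_zero_iff, ← hG, ht, map_zero]

end Exactness

end BalTensor

/-! ### Equational consequences of flatness and purity. -/

namespace BalTensor

section Equations

variable {A : Type u} [Ring A] {m n : ℕ}

/-- Moving the scalars `P j i` across the tensor sign trades linear conditions on the `y i` for a
tensor with the matrix columns. For flatness `e` is the standard basis of `Aⁿ`; for purity, its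
classes modulo the image of the matrix. -/
theorem sum_comb_tmul {Z N : Type*} [AddCommGroup Z] [Module Aᵐᵒᵖ Z] [AddCommGroup N] [Module A N]
    (P : Fin n → Fin m → A) (e : Fin n → Z) (y : Fin m → N) :
    ∑ i, tmul A (∑ j, op (P j i) • e j) (y i) = ∑ j, tmul A (e j) (∑ i, P j i • y i) := by
  simp only [sum_tmul, tmul_sum, smul_tmul]
  exact Finset.sum_comm

theorem sum_tmul_comb {Z N : Type*} [AddCommGroup Z] [Module A Z] [AddCommGroup N]
    [Module Aᵐᵒᵖ N] (P : Fin n → Fin m → A) (e : Fin n → Z) (x : Fin m → N) :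
    ∑ i, tmul A (x i) (∑ j, P j i • e j) = ∑ j, tmul A (∑ i, op (P j i) • x i) (e j) := by
  simp only [sum_tmul, tmul_sum, smul_tmul]
  exact Finset.sum_comm

/-- The standard basis of `Aⁿ`, in a larger universe. -/
def stdBasis (A : Type u) [Ring A] (n : ℕ) (j : Fin n) : ULift.{v} (Fin n → A) :=
  ⟨Pi.single j 1⟩

theorem combRight_stdBasis (P : Fin n → Fin m → A) (i : Fin m) :
    (∑ j, op (P j i) • stdBasis.{u, v} A n j) = ⟨fun j => P j i⟩ := by
  apply ULift.down_injective
  ext s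
  have : (∑ j, op (P j i) • stdBasis.{u, v} A n j).down
      = ∑ j, op (P j i) • (Pi.single j 1 : Fin n → A) :=
    map_sum (ULift.moduleEquiv : ULift.{v} (Fin n → A) ≃ₗ[Aᵐᵒᵖ] (Fin n → A)) _ _
  rw [this]
  simp [Finset.sum_apply, Pi.single_apply]

theorem combLeft_stdBasis (P : Fin n → Fin m → A) (i : Fin m) :
    (∑ j, P j i • stdBasis.{u, v} A n j) = ⟨fun j => P j i⟩ := by
  apply ULift.down_injective
  ext s
  have : (∑ j, P j i • stdBasis.{u, v} A n j).down
      = ∑ j, P j i • (Pi.single j 1 : Fin n → A) :=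
    map_sum (ULift.moduleEquiv : ULift.{v} (Fin n → A) ≃ₗ[A] (Fin n → A)) _ _
  rw [this]
  simp [Finset.sum_apply, Pi.single_apply]

/-- The right linear map `Aᵐ → Aⁿ` with matrix `P`. -/
def matRight (P : Fin n → Fin m → A) : (Fin m → A) →ₗ[Aᵐᵒᵖ] ULift.{v} (Fin n → A) :=
  ULift.moduleEquiv.symm.toLinearMap ∘ₗ LinearMap.pi fun j => dotRight (P j)

/-- The left linear map `Aᵐ → Aⁿ` with matrix `P`. -/
def matLeft (P : Fin n → Fin m → A) : (Fin m → A) →ₗ[A] ULift.{v} (Fin n → A) :=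
  ULift.moduleEquiv.symm.toLinearMap ∘ₗ LinearMap.pi fun j => dotLeft (P j)

theorem matRight_apply (P : Fin n → Fin m → A) (r : Fin m → A) :
    matRight.{u, v} P r = ⟨fun j => P j ⬝ᵥ r⟩ := rfl

theorem matLeft_apply (P : Fin n → Fin m → A) (r : Fin m → A) :
    matLeft.{u, v} P r = ⟨fun j => r ⬝ᵥ P j⟩ := rfl

theorem matRight_single (P : Fin n → Fin m → A) (i : Fin m) :
    matRight.{u, v} P (Pi.single i 1) = ∑ j, op (P j i) • stdBasis.{u, v} A n j := by
  rw [combRight_stdBasis, matRight_apply]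
  simp

theorem matLeft_single (P : Fin n → Fin m → A) (i : Fin m) :
    matLeft.{u, v} P (Pi.single i 1) = ∑ j, P j i • stdBasis.{u, v} A n j := by
  rw [combLeft_stdBasis, matLeft_apply]
  simp

variable {X : Type*} [AddCommGroup X]

theorem combRight_single [Module Aᵐᵒᵖ X] (x : Fin m → X) (i : Fin m) :
    combRight (A := A) x (Pi.single i 1) = x i := by
  change ∑ k, op ((Pi.single i 1 : Fin m → A) k) • x k = x i
  rw [Finset.sum_eq_single i (fun k _ hk => by simp [hk]) (by simp)]
  simp

theorem combLeft_single [Module A X] (x : Fin m → X) (i : Fin m) :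
    combLeft (A := A) x (Pi.single i 1) = x i := by
  change ∑ k, (Pi.single i 1 : Fin m → A) k • x k = x i
  rw [Finset.sum_eq_single i (fun k _ hk => by simp [hk]) (by simp)]
  simp

/-- The equational consequence of flatness of a left module. -/
theorem _root_.IsFlatLeft.sum_tmul_eq_zero {N : Type v} [AddCommGroup N] [Module A N]
    (hN : IsFlatLeft A N) [Module Aᵐᵒᵖ X] (x : Fin m → X) (P : Fin n → Fin m → A)
    (hP : ∀ r, (∀ j, P j ⬝ᵥ r = 0) → combRight x r = 0) (y : Fin m → N)
    (hy : ∀ j, ∑ i, P j i • y i = 0) : ∑ i, tmul A (x i) (y i) = 0 := by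
  let p := matRight.{u, v} P
  have hker : LinearMap.ker p ≤ LinearMap.ker (combRight x) :=
    fun r hr => hP r fun j => congrFun (congrArg ULift.down hr) j
  -- The image of `p` is `Aᵐ / ker p`, so the relations in `hP` let it map to `X` by `p eᵢ ↦ xᵢ`.
  -- Flatness is tested only on this image inside `Aⁿ`, whatever the universe of `X`.
  let ψ : LinearMap.range p →ₗ[Aᵐᵒᵖ] X :=
    (LinearMap.ker p).liftQ (combRight x) hker ∘ₗ p.quotKerEquivRange.symm.toLinearMap
  have hψ : ∀ r, ψ ⟨p r, r, rfl⟩ = combRight x r := fun r => by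
    have : p.quotKerEquivRange.symm ⟨p r, r, rfl⟩ = Submodule.Quotient.mk r :=
      p.quotKerEquivRange.symm_apply_eq.2 rfl
    change (LinearMap.ker p).liftQ (combRight x) hker (p.quotKerEquivRange.symm ⟨p r, r, rfl⟩) = _
    rw [this]
    rfl
  -- `w` lifts the given tensor along `ψ`. In `Aⁿ ⊗ N` it becomes `∑ⱼ eⱼ ⊗ ∑ᵢ Pⱼᵢ yᵢ = 0`, so it
  -- already vanishes by flatness.
  let w : BalTensor A (LinearMap.range p) N :=
    ∑ i, tmul A ⟨p (Pi.single i 1), Pi.single i 1, rfl⟩ (y i)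
  have hw : w = 0 := by
    have hzero : map (LinearMap.range p).subtype (LinearMap.id : N →ₗ[A] N) w = 0 := by
      simp only [w, map_sum, map_tmul, LinearMap.id_apply, Submodule.subtype_apply, p,
        matRight_single, sum_comb_tmul, hy, tmul_zero, Finset.sum_const_zero]
    exact hN _ _ (LinearMap.range p).subtype Subtype.val_injective (hzero.trans (map_zero _).symm)
  have := congrArg (map ψ (LinearMap.id : N →ₗ[A] N)) hw
  simpa only [w, map_sum, map_tmul, LinearMap.id_apply, hψ, combRight_single, map_zero] using this

/-- The equational consequence of flatness of a right module. -/
theorem _root_.IsFlatRight.sum_tmul_eq_zero {N : Type v} [AddCommGroup N] [Module Aᵐᵒᵖ N]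
    (hN : IsFlatRight A N) [Module A X] (x : Fin m → X) (P : Fin n → Fin m → A)
    (hP : ∀ r, (∀ j, r ⬝ᵥ P j = 0) → combLeft x r = 0) (y : Fin m → N)
    (hy : ∀ j, ∑ i, op (P j i) • y i = 0) : ∑ i, tmul A (y i) (x i) = 0 := by
  let p := matLeft.{u, v} P
  have hker : LinearMap.ker p ≤ LinearMap.ker (combLeft x) :=
    fun r hr => hP r fun j => congrFun (congrArg ULift.down hr) j
  let ψ : LinearMap.range p →ₗ[A] X :=
    (LinearMap.ker p).liftQ (combLeft x) hker ∘ₗ p.quotKerEquivRange.symm.toLinearMap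
  have hψ : ∀ r, ψ ⟨p r, r, rfl⟩ = combLeft x r := fun r => by
    have : p.quotKerEquivRange.symm ⟨p r, r, rfl⟩ = Submodule.Quotient.mk r :=
      p.quotKerEquivRange.symm_apply_eq.2 rfl
    change (LinearMap.ker p).liftQ (combLeft x) hker (p.quotKerEquivRange.symm ⟨p r, r, rfl⟩) = _
    rw [this]
    rfl
  let w : BalTensor A N (LinearMap.range p) :=
    ∑ i, tmul A (y i) ⟨p (Pi.single i 1), Pi.single i 1, rfl⟩
  have hw : w = 0 := by
    have hzero : map (LinearMap.id : N →ₗ[Aᵐᵒᵖ] N) (LinearMap.range p).subtype w = 0 := by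
      simp only [w, map_sum, map_tmul, LinearMap.id_apply, Submodule.subtype_apply, p,
        matLeft_single, sum_tmul_comb, hy, zero_tmul, Finset.sum_const_zero]
    exact hN _ _ (LinearMap.range p).subtype Subtype.val_injective (hzero.trans (map_zero _).symm)
  have := congrArg (map (LinearMap.id : N →ₗ[Aᵐᵒᵖ] N) ψ) hw
  simpa only [w, map_sum, map_tmul, LinearMap.id_apply, hψ, combLeft_single, map_zero] using this

/-- A finite system of equations with constants in a pure left submodule which is solvable in the
ambient module is solvable in the submodule. -/
theorem _root_.IsPureLeft.exists_solution {N : Type v} [AddCommGroup N] [Module A N]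
    {L : Submodule A N} (hL : IsPureLeft L) (P : Fin n → Fin m → A) (y : Fin m → N)
    (hy : ∀ j, ∑ i, P j i • y i ∈ L) :
    ∃ l : Fin m → L, ∀ j, ∑ i, P j i • (l i : N) = ∑ i, P j i • y i := by
  let p := matRight.{u, v} P
  let t : BalTensor A (ULift.{v} (Fin n → A)) L :=
    ∑ j, tmul A (stdBasis A n j) ⟨∑ i, P j i • y i, hy j⟩
  -- Purity is tested on the cokernel of `p`: over `N` the image of `t` is `∑ᵢ [p eᵢ] ⊗ yᵢ = 0`, so
  -- it vanishes over `L` too.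
  have ht : map (LinearMap.range p).mkQ (LinearMap.id : L →ₗ[A] L) t = 0 := by
    apply hL (ULift.{v} (Fin n → A) ⧸ LinearMap.range p)
    simp only [t, map_sum, map_tmul, LinearMap.id_apply, Submodule.subtype_apply, map_zero]
    rw [← sum_comb_tmul]
    refine Finset.sum_eq_zero fun i _ => ?_
    have : ∑ j, op (P j i) • (LinearMap.range p).mkQ (stdBasis A n j) = 0 := by
      have h : (LinearMap.range p).mkQ (p (Pi.single i 1)) = 0 :=
        (Submodule.Quotient.mk_eq_zero _).2 ⟨_, rfl⟩
      rw [show p (Pi.single i 1) = _ from matRight_single P i, map_sum] at h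
      simpa only [map_smul] using h
    rw [this, zero_tmul]
  obtain ⟨s, hs⟩ := mem_range_of_map_mkQ_left_eq_zero _ ht
  let c (j : Fin n) : BalTensor A (ULift.{v} (Fin n → A)) L →+ L :=
    leftContract (LinearMap.proj j ∘ₗ (ULift.moduleEquiv :
      ULift.{v} (Fin n → A) ≃ₗ[Aᵐᵒᵖ] (Fin n → A)).toLinearMap)
  -- `c j` reads off the `j`-th coordinate in `Aⁿ ⊗ L ≅ Lⁿ`. On `p r ⊗ l` it gives `(Pⱼ · r) l`, so
  -- the tuple `(rᵢ l)ᵢ` solves the system.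
  have key : ∀ s : BalTensor A (LinearMap.range p) L, ∃ l : Fin m → L, ∀ j,
      c j (map (LinearMap.range p).subtype LinearMap.id s) = ∑ i, P j i • l i := by
    intro s
    induction s using induction_on with
    | htmul q l =>
      obtain ⟨_, r, rfl⟩ := q
      refine ⟨fun i => r i • l, fun j => ?_⟩
      change (P j ⬝ᵥ r) • l = _
      simp only [dotProduct, Finset.sum_smul, mul_smul]
    | hadd s t hs ht =>
      obtain ⟨l, hl⟩ := hs
      obtain ⟨l', hl'⟩ := ht
      exact ⟨l + l', fun j => by
        simp only [map_add, hl, hl', Pi.add_apply, smul_add, Finset.sum_add_distrib]⟩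
  obtain ⟨l, hl⟩ := key s
  refine ⟨l, fun j => ?_⟩
  have h1 : c j t = ⟨∑ i, P j i • y i, hy j⟩ := by
    simp only [t, map_sum]
    change ∑ k, (Pi.single k 1 : Fin n → A) j • (⟨∑ i, P k i • y i, hy k⟩ : L) = _
    rw [Finset.sum_eq_single j (fun k _ hk => by simp [hk.symm]) (by simp)]
    simp
  have h2 := congrArg Subtype.val (h1.symm.trans ((congrArg (c j) hs.symm).trans (hl j)))
  simpa using h2.symm

/-- A finite system of equations with constants in a pure right submodule which is solvable in the
ambient module is solvable in the submodule. -/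
theorem _root_.IsPureRight.exists_solution {N : Type v} [AddCommGroup N] [Module Aᵐᵒᵖ N]
    {L : Submodule Aᵐᵒᵖ N} (hL : IsPureRight L) (P : Fin n → Fin m → A) (y : Fin m → N)
    (hy : ∀ j, ∑ i, op (P j i) • y i ∈ L) :
    ∃ l : Fin m → L, ∀ j, ∑ i, op (P j i) • (l i : N) = ∑ i, op (P j i) • y i := by
  let p := matLeft.{u, v} P
  let t : BalTensor A L (ULift.{v} (Fin n → A)) :=
    ∑ j, tmul A ⟨∑ i, op (P j i) • y i, hy j⟩ (stdBasis A n j)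
  have ht : map (LinearMap.id : L →ₗ[Aᵐᵒᵖ] L) (LinearMap.range p).mkQ t = 0 := by
    apply hL (ULift.{v} (Fin n → A) ⧸ LinearMap.range p)
    simp only [t, map_sum, map_tmul, LinearMap.id_apply, Submodule.subtype_apply, map_zero]
    rw [← sum_tmul_comb]
    refine Finset.sum_eq_zero fun i _ => ?_
    have : ∑ j, P j i • (LinearMap.range p).mkQ (stdBasis A n j) = 0 := by
      have h : (LinearMap.range p).mkQ (p (Pi.single i 1)) = 0 :=
        (Submodule.Quotient.mk_eq_zero _).2 ⟨_, rfl⟩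
      rw [show p (Pi.single i 1) = _ from matLeft_single P i, map_sum] at h
      simpa only [map_smul] using h
    rw [this, tmul_zero]
  obtain ⟨s, hs⟩ := mem_range_of_map_mkQ_right_eq_zero _ ht
  let c (j : Fin n) : BalTensor A L (ULift.{v} (Fin n → A)) →+ L :=
    rightContract (LinearMap.proj j ∘ₗ (ULift.moduleEquiv :
      ULift.{v} (Fin n → A) ≃ₗ[A] (Fin n → A)).toLinearMap)
  have key : ∀ s : BalTensor A L (LinearMap.range p), ∃ l : Fin m → L, ∀ j,
      c j (map LinearMap.id (LinearMap.range p).subtype s) = ∑ i, op (P j i) • l i := by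
    intro s
    induction s using induction_on with
    | htmul l q =>
      obtain ⟨_, r, rfl⟩ := q
      refine ⟨fun i => op (r i) • l, fun j => ?_⟩
      change op (r ⬝ᵥ P j) • l = _
      simp only [dotProduct, Finset.op_sum, op_mul, Finset.sum_smul, mul_smul]
    | hadd s t hs ht =>
      obtain ⟨l, hl⟩ := hs
      obtain ⟨l', hl'⟩ := ht
      exact ⟨l + l', fun j => by
        simp only [map_add, hl, hl', Pi.add_apply, smul_add, Finset.sum_add_distrib]⟩
  obtain ⟨l, hl⟩ := key s
  refine ⟨l, fun j => ?_⟩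
  have h1 : c j t = ⟨∑ i, op (P j i) • y i, hy j⟩ := by
    simp only [t, map_sum]
    change ∑ k, op ((Pi.single k 1 : Fin n → A) j) • (⟨∑ i, op (P k i) • y i, hy k⟩ : L) = _
    rw [Finset.sum_eq_single j (fun k _ hk => by simp [hk.symm]) (by simp)]
    simp
  have h2 := congrArg Subtype.val (h1.symm.trans ((congrArg (c j) hs.symm).trans (hl j)))
  simpa using h2.symm

end Equations

/-! ### Detecting `X ⊗ L` by linear forms. -/

section Detection

variable {A : Type u} [Ring A]

/-- Over a quasi-Frobenius ring, membership of a tensor in `X ⊗ L`, for `L` pure in a flat left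
module, is detected by the linear forms on `X`. -/
theorem _root_.IsQuasiFrobenius.mem_range_of_leftContract (hA : IsQuasiFrobenius A)
    {X : Type*} [AddCommGroup X] [Module Aᵐᵒᵖ X] {N : Type v} [AddCommGroup N] [Module A N]
    (hN : IsFlatLeft A N) {L : Submodule A N} (hL : IsPureLeft L) (z : BalTensor A X N)
    (hz : ∀ φ : X →ₗ[Aᵐᵒᵖ] A, leftContract φ z ∈ L) :
    z ∈ (map (LinearMap.id : X →ₗ[Aᵐᵒᵖ] X) L.subtype).range := by
  obtain ⟨m, x, y, rfl⟩ := exists_eq_sum z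
  obtain ⟨n, P, hP⟩ := hA.exists_equations_right (LinearMap.ker (combRight x))
  -- Each equation vanishes on the relations among the `x i`, so it defines a form on their span,
  -- which extends to `X`.
  choose φ hφ using fun j =>
    (Module.Baer.of_injective hA.right_injective).exists_comp_eq (combRight x) (dotRight (P j))
      (fun r hr => (hP r).1 hr j)
  have hφx : ∀ j i, φ j (x i) = P j i := fun j i => by
    rw [← combRight_single (A := A) x i, hφ]
    exact dotProduct_single_one (P j) i
  have hy : ∀ j, ∑ i, P j i • y i ∈ L := fun j => by
    have := hz (φ j)
    simpa only [map_sum, leftContract, lift_tmul, AddMonoidHom.mk'_apply, hφx] using this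
  obtain ⟨l, hl⟩ := hL.exists_solution P y hy
  -- The differences `y i - l i` satisfy every equation `P j`, so flatness annihilates their tensor
  -- with the `x i`.
  have h0 := hN.sum_tmul_eq_zero x P (fun r hr => (hP r).2 hr) (fun i => y i - l i)
    (fun j => by simp only [smul_sub, Finset.sum_sub_distrib, hl, sub_self])
  simp only [tmul_sub, Finset.sum_sub_distrib, sub_eq_zero] at h0
  exact ⟨∑ i, tmul A (x i) (l i), by rw [h0, map_sum]; rfl⟩

/-- Over a quasi-Frobenius ring, membership of a tensor in `L ⊗ X`, for `L` pure in a flat right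
module, is detected by the linear forms on `X`. -/
theorem _root_.IsQuasiFrobenius.mem_range_of_rightContract (hA : IsQuasiFrobenius A)
    {X : Type*} [AddCommGroup X] [Module A X] {N : Type v} [AddCommGroup N] [Module Aᵐᵒᵖ N]
    (hN : IsFlatRight A N) {L : Submodule Aᵐᵒᵖ N} (hL : IsPureRight L) (z : BalTensor A N X)
    (hz : ∀ φ : X →ₗ[A] A, rightContract φ z ∈ L) :
    z ∈ (map L.subtype (LinearMap.id : X →ₗ[A] X)).range := by
  obtain ⟨m, y, x, rfl⟩ := exists_eq_sum z
  obtain ⟨n, P, hP⟩ := hA.exists_equations_left (LinearMap.ker (combLeft x))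
  choose φ hφ using fun j =>
    (Module.Baer.of_injective hA.left_injective).exists_comp_eq (combLeft x) (dotLeft (P j))
      (fun r hr => (hP r).1 hr j)
  have hφx : ∀ j i, φ j (x i) = P j i := fun j i => by
    rw [← combLeft_single (A := A) x i, hφ]
    exact single_one_dotProduct i (P j)
  have hy : ∀ j, ∑ i, op (P j i) • y i ∈ L := fun j => by
    have := hz (φ j)
    simpa only [map_sum, rightContract, lift_tmul, AddMonoidHom.mk'_apply, hφx] using this
  obtain ⟨l, hl⟩ := hL.exists_solution P y hy
  have h0 := hN.sum_tmul_eq_zero x P (fun r hr => (hP r).2 hr) (fun i => y i - l i)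
    (fun j => by simp only [smul_sub, Finset.sum_sub_distrib, hl, sub_self])
  simp only [sub_tmul, Finset.sum_sub_distrib, sub_eq_zero] at h0
  exact ⟨∑ i, tmul A (l i) (x i), by rw [h0, map_sum]; rfl⟩

end Detection

end BalTensor

/-! ### Contraction of tensors against linear forms. -/

section Contraction

variable {A : Type*} [Ring A] {X Y X' Y' : Type*}
  [AddCommGroup X] [AddCommGroup Y] [AddCommGroup X'] [AddCommGroup Y']
  [Module Aᵐᵒᵖ X] [Module A Y] [Module Aᵐᵒᵖ X'] [Module A Y']

namespace BalTensor

theorem leftContract_map (φ : X' →ₗ[Aᵐᵒᵖ] A) (f : X →ₗ[Aᵐᵒᵖ] X') (g : Y →ₗ[A] Y')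
    (t : BalTensor A X Y) :
    leftContract φ (map f g t) = g (leftContract (φ ∘ₗ f) t) := by
  induction t using induction_on with
  | htmul x y => exact (g.map_smul _ _).symm
  | hadd s t hs ht => simp only [map_add, hs, ht]

theorem rightContract_map (φ : Y' →ₗ[A] A) (f : X →ₗ[Aᵐᵒᵖ] X') (g : Y →ₗ[A] Y')
    (t : BalTensor A X Y) :
    rightContract φ (map f g t) = f (rightContract (φ ∘ₗ g) t) := by
  induction t using induction_on with
  | htmul x y => exact (f.map_smul _ _).symm
  | hadd s t hs ht => simp only [map_add, hs, ht]

theorem leftContract_eq_zero (t : BalTensor A X Y) :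
    leftContract (0 : X →ₗ[Aᵐᵒᵖ] A) t = 0 := by
  induction t using induction_on with
  | htmul x y => exact zero_smul A y
  | hadd s t hs ht => rw [map_add, hs, ht, add_zero]

theorem rightContract_eq_zero (t : BalTensor A X Y) :
    rightContract (0 : Y →ₗ[A] A) t = 0 := by
  induction t using induction_on with
  | htmul x y => exact zero_smul Aᵐᵒᵖ x
  | hadd s t hs ht => rw [map_add, hs, ht, add_zero]

/-- Contraction kills the summand from `K ⊗ Y` and carries the one from `X ⊗ L` into `L`. -/
theorem leftContract_mem_of_mem_sup {K : Submodule Aᵐᵒᵖ X} {L : Submodule A Y}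
    {φ : X →ₗ[Aᵐᵒᵖ] A} (hφ : ∀ k ∈ K, φ k = 0) {t : BalTensor A X Y}
    (ht : t ∈ (map K.subtype (LinearMap.id : Y →ₗ[A] Y)).range ⊔
      (map (LinearMap.id : X →ₗ[Aᵐᵒᵖ] X) L.subtype).range) : leftContract φ t ∈ L := by
  obtain ⟨_, ⟨s, rfl⟩, _, ⟨t, rfl⟩, rfl⟩ := AddSubgroup.mem_sup.1 ht
  have h0 : φ ∘ₗ K.subtype = 0 := LinearMap.ext fun k => hφ k k.2
  rw [map_add, leftContract_map, leftContract_map, h0, leftContract_eq_zero, map_zero, zero_add]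
  exact Subtype.property _

theorem rightContract_mem_of_mem_sup {K : Submodule Aᵐᵒᵖ X} {L : Submodule A Y}
    {φ : Y →ₗ[A] A} (hφ : ∀ l ∈ L, φ l = 0) {t : BalTensor A X Y}
    (ht : t ∈ (map K.subtype (LinearMap.id : Y →ₗ[A] Y)).range ⊔
      (map (LinearMap.id : X →ₗ[Aᵐᵒᵖ] X) L.subtype).range) : rightContract φ t ∈ K := by
  obtain ⟨_, ⟨s, rfl⟩, _, ⟨t, rfl⟩, rfl⟩ := AddSubgroup.mem_sup.1 ht
  have h0 : φ ∘ₗ L.subtype = 0 := LinearMap.ext fun l => hφ l l.2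
  rw [map_add, rightContract_map, rightContract_map, h0, rightContract_eq_zero, map_zero, add_zero]
  exact Subtype.property _

/-- Contraction in the first factor as a right linear map. -/
def leftContractLinear [Module Aᵐᵒᵖ Y] [SMulCommClass A Aᵐᵒᵖ Y] (φ : X →ₗ[Aᵐᵒᵖ] A) :
    BalTensor A X Y →ₗ[Aᵐᵒᵖ] Y where
  toFun := leftContract φ
  map_add' := map_add _
  map_smul' b t := by
    induction t using induction_on with
    | htmul x y => exact smul_comm (φ x) b y
    | hadd s t hs ht => rw [smul_add, map_add, map_add, hs, ht, smul_add]

/-- Contraction in the second factor as a left linear map. -/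
def rightContractLinear [Module A X] [SMulCommClass A Aᵐᵒᵖ X] (φ : Y →ₗ[A] A) :
    BalTensor A X Y →ₗ[A] X where
  toFun := rightContract φ
  map_add' := map_add _
  map_smul' b t := by
    induction t using induction_on with
    | htmul x y => exact (smul_comm b (op (φ y)) x).symm
    | hadd s t hs ht => rw [smul_add, map_add, map_add, hs, ht, smul_add]

variable {Z : Type*} [AddCommGroup Z] [Module A Z] [Module Aᵐᵒᵖ Y] [SMulCommClass A Aᵐᵒᵖ Y]

/-- Contracting the first of three factors is independent of the bracketing. Through this,
coassociativity yields colinearity of `endRight`. -/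
theorem leftContract_assoc (φ : X →ₗ[Aᵐᵒᵖ] A) (t : BalTensor A (BalTensor A X Y) Z) :
    leftContract φ (assoc A X Y Z t) = map (leftContractLinear φ) LinearMap.id t := by
  induction t using induction_on with
  | htmul s z =>
    induction s using induction_on with
    | htmul x y => rfl
    | hadd s t hs ht => simp only [add_tmul, map_add, hs, ht]
  | hadd s t hs ht => simp only [map_add, hs, ht]

theorem map_rightContract_assoc (φ : Z →ₗ[A] A) (t : BalTensor A (BalTensor A X Y) Z) :
    map LinearMap.id (rightContractLinear φ) (assoc A X Y Z t) = rightContract φ t := by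
  induction t using induction_on with
  | htmul s z =>
    induction s using induction_on with
    | htmul x y =>
      change tmul A x (op (φ z) • y) = op (φ z) • tmul A x y
      rfl
    | hadd s t hs ht => simp only [add_tmul, map_add, hs, ht]
  | hadd s t hs ht => simp only [map_add, hs, ht]

end BalTensor

end Contraction

/-! ### Colinear endomorphisms and the wedge product. -/

section Coring

variable {A : Type u} [Ring A] {C : Type v} [AddCommGroup C] [Module A C]
    [Module Aᵐᵒᵖ C] [SMulCommClass A Aᵐᵒᵖ C] [Coring A C]

namespace Coring

/-- The right colinear endomorphism `c ↦ φ(c₁) c₂` attached to a right linear form. -/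
def endRight (φ : C →ₗ[Aᵐᵒᵖ] A) : C →ₗ[Aᵐᵒᵖ] C :=
  leftContractLinear φ ∘ₗ (Coring.comul (A := A) (C := C)).right

/-- The left colinear endomorphism `c ↦ c₁ φ(c₂)` attached to a left linear form. -/
def endLeft (φ : C →ₗ[A] A) : C →ₗ[A] C :=
  rightContractLinear φ ∘ₗ (Coring.comul (A := A) (C := C)).left

/-- By coassociativity, `Δ(φ(c₁) c₂) = φ(c₁) c₂ ⊗ c₃`, and the right side is `endRight φ ⊗ id`
applied to `Δ(c)`. -/
theorem isColinear_endRight (φ : C →ₗ[Aᵐᵒᵖ] A) : (rightRegular A C).IsColinear (endRight φ) := by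
  intro c
  change Coring.comul.left (leftContract φ (Coring.comul.toFun c)) =
    map (endRight φ) LinearMap.id (Coring.comul.toFun c)
  have h := leftContract_map φ (LinearMap.id : C →ₗ[Aᵐᵒᵖ] C)
    (Coring.comul (A := A) (C := C)).left (Coring.comul.toFun c)
  rw [LinearMap.comp_id] at h
  rw [← h, ← Coring.coassoc, leftContract_assoc, map_comp_apply]
  rfl

theorem isColinear_endLeft (φ : C →ₗ[A] A) : (leftRegular A C).IsColinear (endLeft φ) := by
  intro c
  change Coring.comul.right (rightContract φ (Coring.comul.toFun c)) =
    map LinearMap.id (endLeft φ) (Coring.comul.toFun c)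
  have h := rightContract_map φ (Coring.comul (A := A) (C := C)).right
    (LinearMap.id : C →ₗ[A] C) (Coring.comul.toFun c)
  rw [LinearMap.comp_id] at h
  rw [← h, ← map_rightContract_assoc, Coring.coassoc, map_comp_apply]
  rfl

/-- Apply `ε ⊗ id` to `Δ(f c) = (f ⊗ id)Δ(c)`. -/
theorem eq_leftContract_of_isColinear {f : C →ₗ[Aᵐᵒᵖ] C} (hf : (rightRegular A C).IsColinear f)
    (c : C) : f c = leftContract (Coring.counit.right ∘ₗ f) (Coring.comul.toFun c) := by
  have h1 : Coring.comul.toFun (f c) = map f LinearMap.id (Coring.comul.toFun c) := hf c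
  have h2 := Coring.left_counit (A := A) (f c)
  rw [h1, leftContract_map] at h2
  exact h2.symm

theorem eq_rightContract_of_isColinear {f : C →ₗ[A] C} (hf : (leftRegular A C).IsColinear f)
    (c : C) : f c = rightContract (Coring.counit.left ∘ₗ f) (Coring.comul.toFun c) := by
  have h1 : Coring.comul.toFun (f c) = map LinearMap.id f (Coring.comul.toFun c) := hf c
  have h2 := Coring.right_counit (A := A) (f c)
  rw [h1, rightContract_map] at h2
  exact h2.symm

end Coring

theorem mem_wedge {K : Submodule Aᵐᵒᵖ C} {L : Submodule A C} {c : C} :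
    c ∈ wedge K L ↔ Coring.comul.toFun c ∈ (map K.subtype (LinearMap.id : C →ₗ[A] C)).range ⊔
      (map (LinearMap.id : C →ₗ[Aᵐᵒᵖ] C) L.subtype).range := Iff.rfl

/-- The coideal condition is reduced to `Δ(K) ⊆ Im(K ⊗ C)`, so that right coideals and bicoideals
are treated at once. -/
theorem internalCoproductRight_eq_wedge (hA : IsQuasiFrobenius A) (hC : IsFlatLeft A C)
    {K : Submodule Aᵐᵒᵖ C} {L : Submodule A C}
    (hK : ∀ k ∈ K, Coring.comul.toFun k ∈ (map K.subtype (LinearMap.id : C →ₗ[A] C)).range)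
    (hL : IsPureLeft L) :
    internalCoproductRight A K.toAddSubgroup L.toAddSubgroup = wedge K L := by
  ext c
  constructor
  · intro hc
    have hc' : ∀ φ : C →ₗ[Aᵐᵒᵖ] A, (∀ k ∈ K, φ k = 0) →
        leftContract φ (Coring.comul.toFun c) ∈ L := fun φ hφ =>
      hc (Coring.endRight φ) (Coring.isColinear_endRight φ) fun k hk => by
        -- With `⊥` as second submodule, the contraction of `Δ(k) ∈ Im(K ⊗ C)` lands in zero:
        -- `endRight φ` kills `K`.
        have h := leftContract_mem_of_mem_sup (L := ⊥) hφ
          ((le_sup_left : _ ≤ _ ⊔ (map (LinearMap.id : C →ₗ[Aᵐᵒᵖ] C)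
            (⊥ : Submodule A C).subtype).range) (hK k hk))
        exact (Submodule.mem_bot A).1 h
    -- Forms on `C ⧸ K` are forms on `C` vanishing on `K`, so `hc'` meets the detection criterion.
    obtain ⟨s, hs⟩ := hA.mem_range_of_leftContract hC hL
      (map K.mkQ (LinearMap.id : C →ₗ[A] C) (Coring.comul.toFun c)) fun φ => by
        rw [leftContract_map]
        refine hc' _ fun k hk => ?_
        change φ (K.mkQ k) = 0
        rw [Submodule.mkQ_apply, (Submodule.Quotient.mk_eq_zero K).2 hk, map_zero]
    -- Lift to `t` in `C ⊗ L`; then `Δ(c)` minus the image of `t` dies in `C/K ⊗ C`, hence comes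
    -- from `K ⊗ C`.
    obtain ⟨t, rfl⟩ := map_surjective K.mkQ (LinearMap.id : L →ₗ[A] L) K.mkQ_surjective
      Function.surjective_id s
    have h0 : map K.mkQ (LinearMap.id : C →ₗ[A] C)
        (Coring.comul.toFun c - map LinearMap.id L.subtype t) = 0 := by
      rw [map_sub, ← hs, map_comp_apply, map_comp_apply, sub_eq_zero]
      rfl
    rw [mem_wedge, ← sub_add_cancel (Coring.comul.toFun c) (map LinearMap.id L.subtype t)]
    exact AddSubgroup.add_mem_sup (mem_range_of_map_mkQ_left_eq_zero K h0) ⟨t, rfl⟩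
  · intro hc f hf hfK
    rw [Coring.eq_leftContract_of_isColinear hf]
    refine leftContract_mem_of_mem_sup (fun k hk => ?_) (mem_wedge.1 hc)
    rw [LinearMap.comp_apply, hfK k hk, map_zero]

theorem internalCoproductLeft_eq_wedge (hA : IsQuasiFrobenius A) (hC : IsFlatRight A C)
    {K : Submodule Aᵐᵒᵖ C} {L : Submodule A C}
    (hL : ∀ l ∈ L, Coring.comul.toFun l ∈ (map (LinearMap.id : C →ₗ[Aᵐᵒᵖ] C) L.subtype).range)
    (hK : IsPureRight K) :
    internalCoproductLeft A L.toAddSubgroup K.toAddSubgroup = wedge K L := by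
  ext c
  constructor
  · intro hc
    have hc' : ∀ φ : C →ₗ[A] A, (∀ l ∈ L, φ l = 0) →
        rightContract φ (Coring.comul.toFun c) ∈ K := fun φ hφ =>
      hc (Coring.endLeft φ) (Coring.isColinear_endLeft φ) fun l hl => by
        have h := rightContract_mem_of_mem_sup (K := ⊥) hφ
          ((le_sup_right : _ ≤ (map (⊥ : Submodule Aᵐᵒᵖ C).subtype
            (LinearMap.id : C →ₗ[A] C)).range ⊔ _) (hL l hl))
        exact (Submodule.mem_bot Aᵐᵒᵖ).1 h
    obtain ⟨s, hs⟩ := hA.mem_range_of_rightContract hC hK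
      (map (LinearMap.id : C →ₗ[Aᵐᵒᵖ] C) L.mkQ (Coring.comul.toFun c)) fun φ => by
        rw [rightContract_map]
        refine hc' _ fun l hl => ?_
        change φ (L.mkQ l) = 0
        rw [Submodule.mkQ_apply, (Submodule.Quotient.mk_eq_zero L).2 hl, map_zero]
    obtain ⟨t, rfl⟩ := map_surjective (LinearMap.id : K →ₗ[Aᵐᵒᵖ] K) L.mkQ
      Function.surjective_id L.mkQ_surjective s
    have h0 : map (LinearMap.id : C →ₗ[Aᵐᵒᵖ] C) L.mkQ
        (Coring.comul.toFun c - map K.subtype LinearMap.id t) = 0 := by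
      rw [map_sub, ← hs, map_comp_apply, map_comp_apply, sub_eq_zero]
      rfl
    rw [mem_wedge, ← add_sub_cancel (map K.subtype LinearMap.id t) (Coring.comul.toFun c)]
    exact AddSubgroup.add_mem_sup ⟨t, rfl⟩ (mem_range_of_map_mkQ_right_eq_zero L h0)
  · intro hc f hf hfL
    rw [Coring.eq_rightContract_of_isColinear hf]
    refine rightContract_mem_of_mem_sup (fun l hl => ?_) (mem_wedge.1 hc)
    rw [LinearMap.comp_apply, hfL l hl, map_zero]

theorem IsRightCoideal.comul_mem_range {K : Submodule Aᵐᵒᵖ C} (hK : IsRightCoideal (A := A) K) :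
    ∀ k ∈ K, Coring.comul.toFun k ∈ (map K.subtype (LinearMap.id : C →ₗ[A] C)).range := by
  obtain ⟨S, hS⟩ := hK
  exact fun k hk => ⟨S.coact ⟨k, hk⟩, hS ⟨k, hk⟩⟩

theorem IsLeftCoideal.comul_mem_range {L : Submodule A C} (hL : IsLeftCoideal L) :
    ∀ l ∈ L, Coring.comul.toFun l ∈ (map (LinearMap.id : C →ₗ[Aᵐᵒᵖ] C) L.subtype).range := by
  obtain ⟨S, hS⟩ := hL
  exact fun l hl => ⟨S.coact ⟨l, hl⟩, hS ⟨l, hl⟩⟩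

theorem IsBicoideal.comul_mem_range_right {B : SubBimodule A C} (hB : IsBicoideal B) :
    ∀ b ∈ B.right,
      Coring.comul.toFun b ∈ (map B.right.subtype (LinearMap.id : C →ₗ[A] C)).range := by
  obtain ⟨S, hS, -⟩ := hB
  intro b hb
  -- The coaction takes values in a tensor product over `B.left`, while the claim concerns
  -- `B.right`. The carriers agree, so the images are compared on pure tensors.
  have h : ∀ t : BalTensor A B.left C, map B.rightSubtype (LinearMap.id : C →ₗ[A] C) t ∈
      (map B.right.subtype (LinearMap.id : C →ₗ[A] C)).range := fun t => by
    induction t using induction_on with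
    | htmul x y => exact ⟨tmul A (⟨x, x.2⟩ : B.right) y, rfl⟩
    | hadd s t hs ht => rw [map_add]; exact add_mem hs ht
  rw [← hS ⟨b, hb⟩]
  exact h _

theorem IsBicoideal.comul_mem_range_left {B : SubBimodule A C} (hB : IsBicoideal B) :
    ∀ b ∈ B.left,
      Coring.comul.toFun b ∈ (map (LinearMap.id : C →ₗ[Aᵐᵒᵖ] C) B.left.subtype).range := by
  obtain ⟨S, -, hS⟩ := hB
  exact fun b hb => ⟨S.leftCoact.toFun ⟨b, hb⟩, hS ⟨b, hb⟩⟩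

end Coring

theorem mainTheorem3 {A : Type u} [Ring A] {C : Type v} [AddCommGroup C] [Module A C]
    [Module Aᵐᵒᵖ C] [SMulCommClass A Aᵐᵒᵖ C] [Coring A C] (hA : IsQuasiFrobenius A)
    (K L : SubBimodule A C) :
    (IsFlatLeft A C → IsRightCoideal K.right → IsRightCoideal L.right → IsPureLeft L.left →
      internalCoproductRight A K.toAddSubgroup L.toAddSubgroup = wedge K.right L.left) ∧
    (IsFlatRight A C → IsLeftCoideal K.left → IsLeftCoideal L.left → IsPureRight K.right →
      internalCoproductLeft A L.toAddSubgroup K.toAddSubgroup = wedge K.right L.left) ∧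
    (IsFlatLeft A C → IsFlatRight A C → IsBicoideal K → IsBicoideal L →
      IsPureLeft L.left → IsPureRight K.right →
      internalCoproductRight A K.toAddSubgroup L.toAddSubgroup = wedge K.right L.left ∧
      wedge K.right L.left = internalCoproductLeft A L.toAddSubgroup K.toAddSubgroup) :=
  ⟨fun hC hK _ hL => internalCoproductRight_eq_wedge hA hC hK.comul_mem_range hL,
    fun hC _ hL hK => internalCoproductLeft_eq_wedge hA hC hL.comul_mem_range hK,
    fun hCl hCr hK hL hLp hKp =>
      ⟨internalCoproductRight_eq_wedge hA hCl hK.comul_mem_range_right hLp,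
        (internalCoproductLeft_eq_wedge hA hCr hL.comul_mem_range_left hKp).symm⟩⟩
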